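/- Let $r\ge 2$, $q=2^r$, and let $W$ be a discrete memoryless channel with input alphabet $\mathcal X=\mathbb Z/q\mathbb Z=\{0,\dots,q-1\}$, finite output alphabet $\mathcal Y$ and transition probabilities $W(y|x)$. Write $x\in\mathcal X$ in binary as $x=(x_1,\dots,x_r)$ with $x=\sum_{j=1}^r x_j2^{r-j}$, and let $\mathrm{wt}_r(x)=\max\{j:x_j\neq 0\}$ (with $\mathrm{wt}_r(0)=0$). For any such channel $V$ (with any finite output alphabet), put $$Z(V_{\{x,x'\}})=\sum_y\sqrt{V(y|x)V(y|x')},\qquad Z_v(V)=\frac1{2^r}\sum_{x\in\mathcal X}Z(V_{\{x,x+v\}}),\qquad Z_i(V)=\frac1{2^{i-1}}\sum_{v:\,\mathrm{wt}_r(v)=i}Z_v(V)\quad(1\le i\le r),$$ and $$V^-(y_1,y_2|u_1)=\sum_{u_2\in\mathcal X}\frac1q V(y_1|u_1+u_2)V(y_2|u_2),\qquad V^+(y_1,y_2,u_1|u_2)=\frac1q V(y_1|u_1+u_2)V(y_2|u_2),$$ with all additions in $\mathcal X$ modulo $q$. Let $B_1,B_2,\dots$ be the coordinates of $\Omega=\{+,-\}^{\mathbb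 N}$, equipped with the probability measure $P$ under which they are independent and uniform on $\{+,-\}$; let $W_0=W$, $W_n=(W_{n-1})^{B_n}$ for $n\ge1$, and $Z_{i,n}=Z_i(W_n)$. For $\epsilon>0$ let $D_0=[0,\epsilon)$, $D_1=(1-\epsilon,1]$, and for $k=0,1,\dots,r$ let $$\mathcal R_k(\epsilon)=\Big(\prod_{i=1}^kD_1\Big)\times\Big(\prod_{i=k+1}^rD_0\Big),\qquad B_{k,n}(\epsilon)=\{\omega\in\Omega:(Z_{1,n},\dots,Z_{r,n})\in\mathcal R_k(\epsilon)\}.$$ Then for all $\epsilon,\delta>0$ there is $n_0$ such that for all $n\ge n_0$ $$P\Big(\bigcup_{k=0}^rB_{k,n}(\epsilon)\Big)\ge 1-\delta .$$ Moreover, if $\epsilon\le\frac12$, then for every $n$ the events $B_{0,n}(\epsilon),\dots,B_{r,n}(\epsilon)$ are pairwise disjoint. -/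

import Mathlib

open MeasureTheory

universe u

namespace QaryPolar

/-- The input alphabet `{0, …, q - 1}` with `q = 2 ^ r` and addition modulo `q`. -/
abbrev Alphabet (r : ℕ) : Type := ZMod (2 ^ r)

/-- A discrete memoryless channel with input alphabet `Alphabet r` and a finite output alphabet,
given by its stochastic matrix; `W.prob x y` is the transition probability `W(y | x)`. -/
structure Channel (r : ℕ) where
  Output : Type u
  fintypeOutput : Fintype Output
  prob : Alphabet r → Output → ℝ
  prob_nonneg : ∀ x y, 0 ≤ prob x y
  sum_prob : ∀ x, ∑ y, prob x y = 1

attribute [instance] Channel.fintypeOutput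

namespace Channel

variable {r : ℕ}

/-- The combined channel `W₂(y₁, y₂ | u₁, u₂) = W(y₁ | u₁ + u₂) W(y₂ | u₂)`. -/
noncomputable def combined (W : Channel.{u} r) (u₁ u₂ : Alphabet r) (y₁ y₂ : W.Output) : ℝ :=
  W.prob (u₁ + u₂) y₁ * W.prob u₂ y₂

theorem combined_nonneg (W : Channel.{u} r) (u₁ u₂ : Alphabet r) (y₁ y₂ : W.Output) :
    0 ≤ W.combined u₁ u₂ y₁ y₂ :=
  mul_nonneg (W.prob_nonneg _ _) (W.prob_nonneg _ _)

theorem sum_combined (W : Channel.{u} r) (u₁ u₂ : Alphabet r) :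
    ∑ y₁, ∑ y₂, W.combined u₁ u₂ y₁ y₂ = 1 := by
  simp only [combined, ← Finset.mul_sum, W.sum_prob, mul_one]

theorem sum_alphabet_const (r : ℕ) : ∑ _x : Alphabet r, 1 / (2 : ℝ) ^ r = 1 := by
  simp [ZMod.card]

/-- `W⁻(y₁, y₂ | u₁) = ∑_{u₂} (1/q) W₂(y₁, y₂ | u₁, u₂)`. -/
noncomputable def minus (W : Channel.{u} r) : Channel.{u} r where
  Output := W.Output × W.Output
  fintypeOutput := inferInstance
  prob u₁ y := ∑ u₂ : Alphabet r, 1 / (2 : ℝ) ^ r * W.combined u₁ u₂ y.1 y.2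
  prob_nonneg _ _ := Finset.sum_nonneg fun _ _ =>
    mul_nonneg (by positivity) (W.combined_nonneg _ _ _ _)
  sum_prob u₁ := by
    rw [Finset.sum_comm]
    simp only [← Finset.mul_sum, Fintype.sum_prod_type, sum_combined, mul_one]
    exact sum_alphabet_const r

/-- `W⁺(y₁, y₂, u₁ | u₂) = (1/q) W₂(y₁, y₂ | u₁, u₂)`. -/
noncomputable def plus (W : Channel.{u} r) : Channel.{u} r where
  Output := (W.Output × W.Output) × Alphabet r
  fintypeOutput := inferInstance
  prob u₂ y := 1 / (2 : ℝ) ^ r * W.combined y.2 u₂ y.1.1 y.1.2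
  prob_nonneg _ _ := mul_nonneg (by positivity) (W.combined_nonneg _ _ _ _)
  sum_prob u₂ := by
    rw [Fintype.sum_prod_type, Finset.sum_comm]
    simp only [← Finset.mul_sum, Fintype.sum_prod_type, sum_combined, mul_one]
    exact sum_alphabet_const r

/-- One polarization step; the sign `+` is `true` and the sign `-` is `false`. -/
noncomputable def step (W : Channel.{u} r) (b : Bool) : Channel.{u} r :=
  if b then W.plus else W.minus

/-- `W.polarized ω n` is the channel `W^{b₁ b₂ … bₙ}`, where `bⱼ = ω (j - 1)`: the transformations
are applied successively, `b₁` first. -/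
noncomputable def polarized (W : Channel.{u} r) (ω : ℕ → Bool) : ℕ → Channel.{u} r
  | 0 => W
  | n + 1 => (W.polarized ω n).step (ω n)

/-- The Bhattacharyya distance `Z(W_{x,x'}) = ∑_y √(W(y|x) W(y|x'))`. -/
noncomputable def bhattacharyya (W : Channel.{u} r) (x x' : Alphabet r) : ℝ :=
  ∑ y, Real.sqrt (W.prob x y * W.prob x' y)

/-- `Z_v(W) = 2^{-r} ∑_x Z(W_{x,x+v})`. -/
noncomputable def bhattacharyyaShift (W : Channel.{u} r) (v : Alphabet r) : ℝ :=
  1 / (2 : ℝ) ^ r * ∑ x : Alphabet r, W.bhattacharyya x (x + v)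

end Channel

/-- The `j`-th bit `x_j`, `1 ≤ j ≤ r`, of a symbol `x = (x₁, …, x_r)`: `x₁` is the most
significant and `x_r` the least significant bit, i.e. `x = ∑ⱼ x_j 2^{r-j}`. -/
def bit {r : ℕ} (x : Alphabet r) (j : ℕ) : Bool := x.val.testBit (r - j)

/-- The ordered distance `d_r(x, x') = max {j : x_j ≠ x'_j}` (`0` if `x = x'`). -/
def orderedDist {r : ℕ} (x x' : Alphabet r) : ℕ :=
  ((Finset.Icc 1 r).filter fun j => bit x j ≠ bit x' j).sup id

/-- The ordered weight `wt_r(x) = d_r(x, 0)`. -/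
def orderedWeight {r : ℕ} (x : Alphabet r) : ℕ := orderedDist x 0

/-- The `i`-th average Bhattacharyya distance, `1 ≤ i ≤ r`:
`Z_i(W) = 2^{-(i-1)} ∑_{v : wt_r(v) = i} Z_v(W)`. -/
noncomputable def Channel.avgBhattacharyya {r : ℕ} (W : Channel.{u} r) (i : ℕ) : ℝ :=
  1 / (2 : ℝ) ^ (i - 1) *
    ∑ v ∈ Finset.univ.filter (fun v : Alphabet r => orderedWeight v = i), W.bhattacharyyaShift v

/-- The vector `(Z_{1,n}, …, Z_{r,n})` at the sign sequence `ω`; its coordinates are numbered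
from `0`, so that coordinate `i` is `Z_{i+1,n}`. -/
noncomputable def Channel.bhattacharyyaVector {r : ℕ} (W : Channel.{u} r) (n : ℕ)
    (ω : ℕ → Bool) : Fin r → ℝ :=
  fun i => (W.polarized ω n).avgBhattacharyya (i.val + 1)

/-- The region `R_k(ε) = D₁^k × D₀^{r-k}` with `D₀ = [0, ε)` and `D₁ = (1 - ε, 1]`. -/
def region (r k : ℕ) (ε : ℝ) : Set (Fin r → ℝ) :=
  Set.univ.pi fun i => if i.val < k then Set.Ioc (1 - ε) 1 else Set.Ico 0 ε

/-- The law of a sequence of independent fair signs, i.e. the probability measure on `{+,-}^ℕ`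
that gives each cylinder set fixing the first `n` signs the probability `2^{-n}`. -/
noncomputable def signMeasure : Measure (ℕ → Bool) :=
  Measure.infinitePi fun _ => (PMF.uniformOfFintype Bool).toMeasure

/-- The event `B_{k,n}(ε)` that `(Z_{1,n}, …, Z_{r,n})` lies in `R_k(ε)`. -/
def regionEvent {r : ℕ} (W : Channel.{u} r) (ε : ℝ) (k n : ℕ) : Set (ℕ → Bool) :=
  {ω | W.bhattacharyyaVector n ω ∈ region r k ε}

end QaryPolar

/-!
The mutual information `I(W)` of a uniform input and the output of `W` drives the polarization.
One step conserves it, `I(W⁺) + I(W⁻) = 2 I(W)`, so that `I(W_n)` is a martingale with values in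
`[0, log q]`, and its second moments `𝔼 I(W_n)²` increase and are bounded. Their increments are
`𝔼 (I(W_n) - I(W_n⁻))²`, which therefore tend to `0`.

The step `I(W) - I(W⁻)` is an average of Jensen gaps of `t ↦ -t log t`. A comparison of the
entropy gap with the Hellinger distance and the Cauchy–Schwarz inequality give
`I(W) - I(W⁻) ≥ (1 - Z_v) Z_v² / (2q)` for every shift `v`
(`Channel.information_sub_information_minus_ge`). Hence, with probability tending to `1`, every
`Z_v(W_n)` is close to `0` or to `1` (`Channel.tendsto_measure_exists_mem_Icc`).

What remains concerns a single channel. As `1 - Z_v` is an averaged squared Hellinger distance, it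
satisfies `1 - Z_{v+w} ≤ 2 (1 - Z_v) + 2 (1 - Z_w)`. If no `Z_v` is intermediate, the `v` with `Z_v`
close to `1` thus form a subgroup of `ℤ/2^r`; the subgroups form a chain, and each is
`{v | wt v ≤ k}` for some `k` (`Channel.exists_threshold`). Since `Z_i` is the mean of `Z_v` over the
`2^(i-1)` symbols of weight `i`, the vector of the `Z_i` lies in the region of index `k`.
-/

namespace QaryPolar

open Real

/-! ### The entropy gap in Jensen's inequality -/

/-- The Bregman divergence of `t ↦ t * log t` dominates the squared Hellinger distance; this is
`log t ≤ t - 1` at `t = √(m / a)`. -/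
theorem sq_sqrt_sub_sqrt_le {a m : ℝ} (ha : 0 ≤ a) (hm : 0 < m) :
    (√a - √m) ^ 2 ≤ a * log a - a * log m - a + m := by
  rcases ha.eq_or_lt with rfl | ha
  · simp [Real.sq_sqrt hm.le]
  have h := Real.log_le_sub_one_of_pos (show 0 < √m / √a by positivity)
  rw [Real.log_div (by positivity) (by positivity), Real.log_sqrt hm.le, Real.log_sqrt ha.le] at h
  have h2 : a * (√m / √a) = √a * √m := by
    field_simp
    rw [Real.sq_sqrt ha.le]
  nlinarith [Real.sq_sqrt ha.le, Real.sq_sqrt hm.le, mul_le_mul_of_nonneg_left h ha.le]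

/-- Quantitative Jensen inequality for `negMulLog` with unnormalised weights `p`: the right-hand side
is `∑ p` times the Jensen gap at the weighted mean `m = (∑ p a) / ∑ p`, the left-hand side the
spread of the values `√a` about `√m`. -/
theorem sum_mul_sq_sqrt_sub_le {ι : Type*} [Fintype ι] {p a : ι → ℝ}
    (hp : ∀ u, 0 ≤ p u) (ha : ∀ u, 0 ≤ a u) :
    ∑ u, p u * (√(a u) - √((∑ u, p u * a u) / ∑ u, p u)) ^ 2 ≤
      negMulLog (∑ u, p u * a u) + (∑ u, p u * a u) * log (∑ u, p u)
        - ∑ u, p u * negMulLog (a u) := by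
  set g := ∑ u, p u * a u with hg
  set B := ∑ u, p u with hB
  have hg0 : 0 ≤ g := Finset.sum_nonneg fun u _ => mul_nonneg (hp u) (ha u)
  have hB0 : 0 ≤ B := Finset.sum_nonneg fun u _ => hp u
  -- If `g = 0`, the convention `log 0 = 0` is in play, but every term vanishes separately.
  rcases hg0.eq_or_lt with h0 | hgpos
  · have hz : ∀ u, p u * a u = 0 := fun u =>
      (Finset.sum_eq_zero_iff_of_nonneg fun u _ => mul_nonneg (hp u) (ha u)).1
        (hg.symm.trans h0.symm) u (Finset.mem_univ u)
    rw [← h0]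
    have h1 : ∀ u, p u * negMulLog (a u) = 0 := fun u => by
      rw [negMulLog, neg_mul, mul_neg, ← mul_assoc, hz u]; simp
    have h2 : ∀ u, p u * (√(a u) - √(0 / B)) ^ 2 = 0 := fun u => by
      rw [zero_div, Real.sqrt_zero, sub_zero, Real.sq_sqrt (ha u), hz u]
    rw [Finset.sum_eq_zero fun u _ => h2 u, Finset.sum_eq_zero fun u _ => h1 u]
    simp
  · have hBpos : 0 < B := by
      rcases hB0.eq_or_lt with h | h
      · exfalso
        have hz : ∀ u, p u = 0 := fun u =>
          (Finset.sum_eq_zero_iff_of_nonneg fun u _ => hp u).1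
            (hB.symm.trans h.symm) u (Finset.mem_univ u)
        simp [hg, hz] at hgpos
      · exact h
    have hm : 0 < g / B := div_pos hgpos hBpos
    calc _ ≤ ∑ u, p u * (a u * log (a u) - a u * log (g / B) - a u + g / B) :=
          Finset.sum_le_sum fun u _ =>
            mul_le_mul_of_nonneg_left (sq_sqrt_sub_sqrt_le (ha u) hm) (hp u)
      _ = ∑ u, (-(p u * negMulLog (a u)) - p u * a u * (log (g / B) + 1) + p u * (g / B)) := by
          refine Finset.sum_congr rfl fun u _ => ?_
          rw [negMulLog]; ring
      _ = -(∑ u, p u * negMulLog (a u)) - g * (log (g / B) + 1) + B * (g / B) := by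
          rw [Finset.sum_add_distrib, Finset.sum_sub_distrib, Finset.sum_neg_distrib,
            ← Finset.sum_mul, ← Finset.sum_mul]
      _ = _ := by
          rw [Real.log_div hgpos.ne' hBpos.ne', mul_div_cancel₀ _ hBpos.ne', negMulLog]; ring

/-- The spread of `s` about any centre `c` controls its variation along any permutation `σ`. -/
theorem sum_mul_mul_sq_sub_le {ι : Type*} [Fintype ι] (σ : ι ≃ ι) {p : ι → ℝ} (hp : ∀ u, 0 ≤ p u)
    (s : ι → ℝ) (c : ℝ) :
    ∑ u, p u * p (σ u) * (s u - s (σ u)) ^ 2 ≤ 4 * (∑ u, p u) * ∑ u, p u * (s u - c) ^ 2 := by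
  have hle : ∀ u, p u ≤ ∑ u, p u := fun u =>
    Finset.single_le_sum (fun u _ => hp u) (Finset.mem_univ u)
  have hσ : ∑ u, p (σ u) * (s (σ u) - c) ^ 2 = ∑ u, p u * (s u - c) ^ 2 :=
    Equiv.sum_comp σ fun u => p u * (s u - c) ^ 2
  calc _ ≤ ∑ u, (2 * (∑ u, p u) * (p u * (s u - c) ^ 2)
          + 2 * (∑ u, p u) * (p (σ u) * (s (σ u) - c) ^ 2)) := by
        refine Finset.sum_le_sum fun u _ => ?_
        have h1 : (s u - s (σ u)) ^ 2 ≤ 2 * (s u - c) ^ 2 + 2 * (s (σ u) - c) ^ 2 := by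
          nlinarith [sq_nonneg (s u - c + (s (σ u) - c))]
        have h2 := mul_le_mul_of_nonneg_left h1 (mul_nonneg (hp u) (hp (σ u)))
        have h3 := mul_le_mul_of_nonneg_right (hle (σ u))
          (mul_nonneg (hp u) (sq_nonneg (s u - c)))
        have h4 := mul_le_mul_of_nonneg_right (hle u)
          (mul_nonneg (hp (σ u)) (sq_nonneg (s (σ u) - c)))
        nlinarith
    _ = _ := by
        rw [Finset.sum_add_distrib, ← Finset.mul_sum, ← Finset.mul_sum, hσ]; ring

/-- Lower bound for the Jensen gap that no longer mentions the weighted mean. When all weights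
vanish the division by `0` makes the left-hand side `0`. -/
theorem sum_div_le_negMulLog_gap {ι : Type*} [Fintype ι] (σ : ι ≃ ι) {p a : ι → ℝ}
    (hp : ∀ u, 0 ≤ p u) (ha : ∀ u, 0 ≤ a u) :
    (∑ u, p u * p (σ u) * (√(a u) - √(a (σ u))) ^ 2) / (4 * ∑ u, p u) ≤
      negMulLog (∑ u, p u * a u) + (∑ u, p u * a u) * log (∑ u, p u)
        - ∑ u, p u * negMulLog (a u) := by
  refine le_trans ?_ (sum_mul_sq_sqrt_sub_le hp ha)
  have hB0 : 0 ≤ ∑ u, p u := Finset.sum_nonneg fun u _ => hp u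
  refine div_le_of_le_mul₀ (by positivity)
    (Finset.sum_nonneg fun u _ => mul_nonneg (hp u) (sq_nonneg _)) ?_
  rw [mul_comm]
  exact sum_mul_mul_sq_sub_le σ hp (fun u => √(a u)) _

namespace Channel

variable {r : ℕ}

/-! ### Averaged Bhattacharyya distances -/

theorem sum_add_right (f : Alphabet r → ℝ) (u : Alphabet r) : ∑ x, f (x + u) = ∑ x, f x :=
  Equiv.sum_comp (Equiv.addRight u) f

theorem bhattacharyya_eq (W : Channel.{u} r) (x x' : Alphabet r) :
    ∑ y, (√(W.prob x y) - √(W.prob x' y)) ^ 2 = 2 - 2 * W.bhattacharyya x x' := by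
  have h : ∀ y, (√(W.prob x y) - √(W.prob x' y)) ^ 2
      = W.prob x y + W.prob x' y - 2 * √(W.prob x y * W.prob x' y) := fun y => by
    rw [Real.sqrt_mul (W.prob_nonneg x y), sub_sq, Real.sq_sqrt (W.prob_nonneg _ _),
      Real.sq_sqrt (W.prob_nonneg _ _)]
    ring
  simp only [h, Finset.sum_sub_distrib, Finset.sum_add_distrib, W.sum_prob, ← Finset.mul_sum,
    bhattacharyya]
  ring

/-- `1 - Z_v` is half the average squared Hellinger distance between the outputs of inputs
differing by `v`. -/
theorem bhattacharyyaShift_eq (W : Channel.{u} r) (v : Alphabet r) :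
    1 / (2 : ℝ) ^ r * ∑ x, ∑ y, (√(W.prob x y) - √(W.prob (x + v) y)) ^ 2
      = 2 * (1 - W.bhattacharyyaShift v) := by
  have h := sum_alphabet_const r
  rw [← mul_one (∑ _x : Alphabet r, _), Finset.sum_mul, ← Finset.mul_sum] at h
  simp only [bhattacharyya_eq, Finset.sum_sub_distrib, ← Finset.mul_sum, bhattacharyyaShift]
  rw [show ∑ _x : Alphabet r, (2 : ℝ) = 2 * ∑ _x : Alphabet r, 1 by simp [mul_comm]]
  linear_combination 2 * h

theorem bhattacharyyaShift_nonneg (W : Channel.{u} r) (v : Alphabet r) :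
    0 ≤ W.bhattacharyyaShift v :=
  mul_nonneg (by positivity) (Finset.sum_nonneg fun _ _ => Finset.sum_nonneg fun _ _ =>
    Real.sqrt_nonneg _)

theorem bhattacharyyaShift_le_one (W : Channel.{u} r) (v : Alphabet r) :
    W.bhattacharyyaShift v ≤ 1 := by
  have h : 0 ≤ 1 / (2 : ℝ) ^ r * ∑ x, ∑ y, (√(W.prob x y) - √(W.prob (x + v) y)) ^ 2 := by
    positivity
  rw [bhattacharyyaShift_eq] at h
  linarith

theorem bhattacharyyaShift_zero (W : Channel.{u} r) : W.bhattacharyyaShift 0 = 1 := by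
  have h := W.bhattacharyyaShift_eq 0
  simp only [add_zero, sub_self, ne_eq, OfNat.ofNat_ne_zero, not_false_eq_true, zero_pow,
    Finset.sum_const_zero, mul_zero] at h
  linarith

/-- The triangle inequality for the Hellinger distance, in squared form. -/
theorem one_sub_bhattacharyyaShift_add_le (W : Channel.{u} r) (v w : Alphabet r) :
    1 - W.bhattacharyyaShift (v + w) ≤
      2 * (1 - W.bhattacharyyaShift v) + 2 * (1 - W.bhattacharyyaShift w) := by
  have hv := W.bhattacharyyaShift_eq v
  have hw := W.bhattacharyyaShift_eq w
  have hvw := W.bhattacharyyaShift_eq (v + w)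
  rw [← sum_add_right (fun x => ∑ y, (√(W.prob x y) - √(W.prob (x + w) y)) ^ 2) v] at hw
  have key : ∑ x, ∑ y, (√(W.prob x y) - √(W.prob (x + (v + w)) y)) ^ 2 ≤
      2 * (∑ x, ∑ y, (√(W.prob x y) - √(W.prob (x + v) y)) ^ 2) +
      2 * (∑ x, ∑ y, (√(W.prob (x + v) y) - √(W.prob (x + v + w) y)) ^ 2) := by
    simp only [Finset.mul_sum, ← Finset.sum_add_distrib]
    refine Finset.sum_le_sum fun x _ => Finset.sum_le_sum fun y _ => ?_
    rw [add_assoc]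
    nlinarith [sq_nonneg (√(W.prob x y) - √(W.prob (x + v) y)
      - (√(W.prob (x + v) y) - √(W.prob (x + (v + w)) y)))]
  have := mul_le_mul_of_nonneg_left key (show 0 ≤ 1 / (2 : ℝ) ^ r by positivity)
  linarith

/-! ### Mutual information under one polarization step -/

/-- The output distribution of `W` under a uniform input. -/
noncomputable def outputProb (W : Channel.{u} r) (y : W.Output) : ℝ :=
  1 / (2 : ℝ) ^ r * ∑ x, W.prob x y

/-- The mutual information, in nats, between a uniform input and the output of `W`, written as a sum
over the outputs of the Jensen gaps of `negMulLog` at the conditional probabilities. -/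
noncomputable def information (W : Channel.{u} r) : ℝ :=
  ∑ y, (negMulLog (W.outputProb y) - 1 / (2 : ℝ) ^ r * ∑ x, negMulLog (W.prob x y))

theorem outputProb_nonneg (W : Channel.{u} r) (y : W.Output) : 0 ≤ W.outputProb y :=
  mul_nonneg (by positivity) (Finset.sum_nonneg fun _ _ => W.prob_nonneg _ _)

theorem sum_outputProb (W : Channel.{u} r) : ∑ y, W.outputProb y = 1 := by
  have h := sum_alphabet_const r
  rw [← mul_one (∑ _x : Alphabet r, _), Finset.sum_mul, ← Finset.mul_sum] at h
  simp only [outputProb, ← Finset.mul_sum]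
  rw [Finset.sum_comm]
  simpa only [W.sum_prob] using h

theorem information_nonneg (W : Channel.{u} r) : 0 ≤ W.information := by
  refine Finset.sum_nonneg fun y _ => ?_
  have h := sum_mul_sq_sqrt_sub_le (p := fun _ : Alphabet r => 1 / (2 : ℝ) ^ r)
    (a := fun x => W.prob x y) (fun _ => by positivity) (fun x => W.prob_nonneg x y)
  rw [sum_alphabet_const r] at h
  simp only [← Finset.mul_sum, Real.log_one, mul_zero, add_zero] at h
  exact le_trans (mul_nonneg (by positivity) (Finset.sum_nonneg fun _ _ => sq_nonneg _)) h

theorem information_le (W : Channel.{u} r) : W.information ≤ log (2 ^ r) := by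
  have key : ∀ y, negMulLog (W.outputProb y) - 1 / (2 : ℝ) ^ r * ∑ x, negMulLog (W.prob x y)
      ≤ W.outputProb y * log (2 ^ r) := by
    intro y
    have hle : ∀ x, W.prob x y ≤ 2 ^ r * W.outputProb y := fun x => by
      rw [outputProb, ← mul_assoc, mul_one_div_cancel (by positivity), one_mul]
      exact Finset.single_le_sum (fun x _ => W.prob_nonneg x y) (Finset.mem_univ x)
    have hx : ∀ x, -negMulLog (W.prob x y) ≤
        W.prob x y * (log (2 ^ r) + log (W.outputProb y)) := by
      intro x
      rcases (W.prob_nonneg x y).eq_or_lt with h | h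
      · simp [← h]
      have hA : 0 < W.outputProb y := by
        have h3 := h.trans_le (hle x)
        exact (mul_pos_iff_of_pos_left (by positivity)).1 h3
      rw [← Real.log_mul (by positivity) hA.ne', negMulLog]
      have := mul_le_mul_of_nonneg_left (Real.log_le_log h (hle x)) h.le
      linarith
    have hs := mul_le_mul_of_nonneg_left (Finset.sum_le_sum fun x (_ : x ∈ Finset.univ) => hx x)
      (show 0 ≤ 1 / (2 : ℝ) ^ r by positivity)
    rw [← Finset.sum_mul, ← mul_assoc, ← outputProb, Finset.sum_neg_distrib] at hs
    rw [negMulLog]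
    linarith
  calc _ ≤ ∑ y, W.outputProb y * log (2 ^ r) := Finset.sum_le_sum fun y _ => key y
    _ = _ := by rw [← Finset.sum_mul, sum_outputProb, one_mul]

theorem outputProb_minus (W : Channel.{u} r) (y₁ y₂ : W.Output) :
    W.minus.outputProb (y₁, y₂) = W.outputProb y₁ * W.outputProb y₂ := by
  simp only [outputProb, minus, combined]
  rw [Finset.sum_comm]
  have h : ∀ u₂, ∑ u₁, 1 / (2 : ℝ) ^ r * (W.prob (u₁ + u₂) y₁ * W.prob u₂ y₂)
      = 1 / (2 : ℝ) ^ r * (∑ x, W.prob x y₁) * W.prob u₂ y₂ := fun u₂ => by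
    rw [← Finset.mul_sum, ← Finset.sum_mul,
      sum_add_right (fun x => W.prob x y₁) u₂]
    ring
  rw [Finset.sum_congr rfl fun u₂ _ => h u₂, ← Finset.mul_sum]
  ring

theorem outputProb_plus (W : Channel.{u} r) (y₁ y₂ : W.Output) (u₁ : Alphabet r) :
    W.plus.outputProb ((y₁, y₂), u₁) = 1 / (2 : ℝ) ^ r * W.minus.prob u₁ (y₁, y₂) := by
  simp only [outputProb, plus, minus]

theorem information_plus (W : Channel.{u} r) :
    W.plus.information = ∑ y : W.Output × W.Output, 1 / (2 : ℝ) ^ r * ∑ u₁ : Alphabet r,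
      (negMulLog (W.minus.prob u₁ y)
        - 1 / (2 : ℝ) ^ r * ∑ u₂, negMulLog (W.combined u₁ u₂ y.1 y.2)) := by
  have h0 : W.plus.information = ∑ y : (W.Output × W.Output) × Alphabet r,
      (negMulLog (W.plus.outputProb y) - 1 / (2 : ℝ) ^ r * ∑ x, negMulLog (W.plus.prob x y)) := rfl
  rw [h0, Fintype.sum_prod_type]
  refine Finset.sum_congr rfl fun y _ => ?_
  rw [Finset.mul_sum]
  refine Finset.sum_congr rfl fun u₁ _ => ?_
  rw [outputProb_plus]
  simp only [plus, negMulLog_mul (1 / (2 : ℝ) ^ r), Finset.sum_add_distrib, ← Finset.sum_mul,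
    ← Finset.mul_sum]
  have : W.minus.prob u₁ (y.1, y.2) = 1 / (2 : ℝ) ^ r * ∑ u₂, W.combined u₁ u₂ y.1 y.2 := by
    simp only [minus, ← Finset.mul_sum]
  rw [this]
  ring

theorem mean_mean_negMulLog_combined (W : Channel.{u} r) (y₁ y₂ : W.Output) :
    1 / (2 : ℝ) ^ r * ∑ u₁, 1 / (2 : ℝ) ^ r * ∑ u₂, negMulLog (W.combined u₁ u₂ y₁ y₂) =
      W.outputProb y₂ * (1 / (2 : ℝ) ^ r * ∑ x, negMulLog (W.prob x y₁)) +
      W.outputProb y₁ * (1 / (2 : ℝ) ^ r * ∑ x, negMulLog (W.prob x y₂)) := by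
  rw [← Finset.mul_sum, Finset.sum_comm]
  have h : ∀ u₂, ∑ u₁, negMulLog (W.combined u₁ u₂ y₁ y₂) =
      W.prob u₂ y₂ * (∑ x, negMulLog (W.prob x y₁)) +
      (∑ x, W.prob x y₁) * negMulLog (W.prob u₂ y₂) := fun u₂ => by
    simp only [combined, negMulLog_mul, Finset.sum_add_distrib, ← Finset.mul_sum, ← Finset.sum_mul]
    rw [sum_add_right (fun x => negMulLog (W.prob x y₁)) u₂,
      sum_add_right (fun x => W.prob x y₁) u₂]
  simp only [h, Finset.sum_add_distrib, ← Finset.mul_sum, ← Finset.sum_mul, outputProb]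
  ring

/-- Conservation of mutual information. Everything reduces to
`negMulLog (a * b) = b * negMulLog a + a * negMulLog b`. -/
theorem information_plus_add_information_minus (W : Channel.{u} r) :
    W.plus.information + W.minus.information = 2 * W.information := by
  have hm : W.minus.information = ∑ y : W.Output × W.Output,
      (negMulLog (W.minus.outputProb y)
        - 1 / (2 : ℝ) ^ r * ∑ x, negMulLog (W.minus.prob x y)) := rfl
  rw [information_plus, hm, ← Finset.sum_add_distrib, Fintype.sum_prod_type]
  set I : W.Output → ℝ := fun y =>
    negMulLog (W.outputProb y) - 1 / (2 : ℝ) ^ r * ∑ x, negMulLog (W.prob x y) with hI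
  have hIs : W.information = ∑ y, I y := rfl
  calc _ = ∑ y₁, ∑ y₂, (W.outputProb y₂ * I y₁ + W.outputProb y₁ * I y₂) := by
        refine Finset.sum_congr rfl fun y₁ _ => Finset.sum_congr rfl fun y₂ _ => ?_
        have h := W.mean_mean_negMulLog_combined y₁ y₂
        rw [outputProb_minus, negMulLog_mul, Finset.sum_sub_distrib]
        simp only [hI]
        linear_combination -h
    _ = _ := by
        simp only [Finset.sum_add_distrib, ← Finset.mul_sum, ← Finset.sum_mul, sum_outputProb, hIs]
        ring

/-- The information lost in the minus transform is an average of Jensen gaps of `negMulLog`: the one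
indexed by `y₁, y₂, u₁` takes the values `W(y₁ | u₁ + u₂)`, weighted by `W(y₂ | u₂) / q`. -/
theorem information_sub_information_minus (W : Channel.{u} r) :
    W.information - W.minus.information =
      ∑ y₁, ∑ y₂, 1 / (2 : ℝ) ^ r * ∑ u₁ : Alphabet r,
        (negMulLog (W.minus.prob u₁ (y₁, y₂)) + W.minus.prob u₁ (y₁, y₂) * log (W.outputProb y₂)
          - ∑ u₂, 1 / (2 : ℝ) ^ r * W.prob u₂ y₂ * negMulLog (W.prob (u₁ + u₂) y₁)) := by
  have hm : W.minus.information = ∑ y₁, ∑ y₂,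
      (negMulLog (W.minus.outputProb (y₁, y₂))
        - 1 / (2 : ℝ) ^ r * ∑ x, negMulLog (W.minus.prob x (y₁, y₂))) :=
    Fintype.sum_prod_type (f := fun y : W.Output × W.Output => (negMulLog (W.minus.outputProb y)
        - 1 / (2 : ℝ) ^ r * ∑ x, negMulLog (W.minus.prob x y)))
  have hi : W.information = ∑ y₁, ∑ y₂, W.outputProb y₂ *
      (negMulLog (W.outputProb y₁) - 1 / (2 : ℝ) ^ r * ∑ x, negMulLog (W.prob x y₁)) := by
    simp only [← Finset.sum_mul, sum_outputProb, one_mul, information]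
  rw [hm, hi, ← Finset.sum_sub_distrib]
  refine Finset.sum_congr rfl fun y₁ _ => ?_
  rw [← Finset.sum_sub_distrib]
  refine Finset.sum_congr rfl fun y₂ _ => ?_
  have h1 := W.outputProb_minus y₁ y₂
  have h2 : ∑ u₁, ∑ u₂, 1 / (2 : ℝ) ^ r * W.prob u₂ y₂ * negMulLog (W.prob (u₁ + u₂) y₁)
      = W.outputProb y₂ * ∑ x, negMulLog (W.prob x y₁) := by
    rw [Finset.sum_comm, outputProb, mul_assoc, Finset.sum_mul, Finset.mul_sum]
    refine Finset.sum_congr rfl fun u₂ _ => ?_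
    rw [← Finset.mul_sum, sum_add_right (fun x => negMulLog (W.prob x y₁)) u₂, mul_assoc]
  rw [Finset.sum_sub_distrib, Finset.sum_add_distrib, h2, ← Finset.sum_mul, h1, negMulLog_mul,
    show negMulLog (W.outputProb y₂) = -W.outputProb y₂ * log (W.outputProb y₂) from rfl]
  have h3 : 1 / (2 : ℝ) ^ r * ∑ x, W.minus.prob x (y₁, y₂) = W.outputProb y₁ * W.outputProb y₂ := h1
  linear_combination (-log (W.outputProb y₂)) * h3

/-- By Cauchy–Schwarz, a large `Z_v` means that, given the output, inputs `u` and `u + v` are often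
both likely. -/
theorem sq_bhattacharyyaShift_le (W : Channel.{u} r) (v : Alphabet r) :
    1 / (2 : ℝ) ^ r * W.bhattacharyyaShift v ^ 2 ≤
      ∑ y, ∑ u, (1 / (2 : ℝ) ^ r * W.prob u y) * (1 / (2 : ℝ) ^ r * W.prob (u + v) y)
        / W.outputProb y := by
  set κ : ℝ := 1 / (2 : ℝ) ^ r with hκ
  have hκ0 : 0 < κ := by positivity
  have hq : κ * ∑ _u : Alphabet r, (1 : ℝ) = 1 := by
    rw [Finset.mul_sum, mul_one]; exact sum_alphabet_const r
  have hcs := Finset.sum_sq_le_sum_mul_sum_of_sq_le_mul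
    (Finset.univ : Finset (Alphabet r × W.Output))
    (r := fun z => κ * √(W.prob z.1 z.2 * W.prob (z.1 + v) z.2))
    (f := fun z => (κ * W.prob z.1 z.2) * (κ * W.prob (z.1 + v) z.2) / W.outputProb z.2)
    (g := fun z => W.outputProb z.2)
    (fun z _ => div_nonneg (mul_nonneg (mul_nonneg hκ0.le (W.prob_nonneg _ _))
      (mul_nonneg hκ0.le (W.prob_nonneg _ _))) (W.outputProb_nonneg _))
    (fun z _ => W.outputProb_nonneg _)
    (fun z _ => by
      rw [mul_pow, Real.sq_sqrt (mul_nonneg (W.prob_nonneg _ _) (W.prob_nonneg _ _))]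
      rcases eq_or_ne (W.outputProb z.2) 0 with h | h
      -- An output of probability `0` contributes `0` to both sides.
      · have h' : ∑ x, W.prob x z.2 = 0 := by
          rcases mul_eq_zero.1 h with h | h
          · exact absurd h hκ0.ne'
          · exact h
        have := (Finset.sum_eq_zero_iff_of_nonneg fun x _ => W.prob_nonneg x z.2).1 h' z.1
          (Finset.mem_univ _)
        simp [h, this]
      · rw [div_mul_cancel₀ _ h]; exact le_of_eq (by ring))
  rw [Fintype.sum_prod_type, Fintype.sum_prod_type, Fintype.sum_prod_type] at hcs
  simp only [← Finset.mul_sum, sum_outputProb] at hcs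
  rw [Finset.sum_comm (f := fun x y => κ * W.prob x y * (κ * W.prob (x + v) y) / W.outputProb y)]
    at hcs
  change W.bhattacharyyaShift v ^ 2 ≤ _ at hcs
  have := mul_le_mul_of_nonneg_left hcs hκ0.le
  calc _ ≤ _ := this
    _ = _ := by rw [mul_left_comm, hq, mul_one]

/-- The minus transform loses a definite amount of information whenever some `Z_v` is bounded away
from both `0` and `1`: not small, so that `u₂` is ambiguous by `v` given `y₂`, and not close to `1`,
so that this ambiguity affects the law of `y₁`. -/
theorem information_sub_information_minus_ge (W : Channel.{u} r) (v : Alphabet r) :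
    1 / (2 : ℝ) ^ r / 2 * (1 - W.bhattacharyyaShift v) * W.bhattacharyyaShift v ^ 2 ≤
      W.information - W.minus.information := by
  rw [information_sub_information_minus]
  set κ : ℝ := 1 / (2 : ℝ) ^ r with hκ
  have hκ0 : 0 < κ := by positivity
  have hgap : ∀ y₁ y₂ u₁, (∑ u, (κ * W.prob u y₂) * (κ * W.prob (u + v) y₂) *
        (√(W.prob (u₁ + u) y₁) - √(W.prob (u₁ + (u + v)) y₁)) ^ 2) / (4 * W.outputProb y₂) ≤
      negMulLog (W.minus.prob u₁ (y₁, y₂)) + W.minus.prob u₁ (y₁, y₂) * log (W.outputProb y₂)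
          - ∑ u₂, κ * W.prob u₂ y₂ * negMulLog (W.prob (u₁ + u₂) y₁) := by
    intro y₁ y₂ u₁
    have h := sum_div_le_negMulLog_gap (Equiv.addRight v) (p := fun u => κ * W.prob u y₂)
      (a := fun u => W.prob (u₁ + u) y₁) (fun u => mul_nonneg hκ0.le (W.prob_nonneg _ _))
      (fun u => W.prob_nonneg _ _)
    have hB : ∑ u, κ * W.prob u y₂ = W.outputProb y₂ := by rw [outputProb, Finset.mul_sum]
    have hg : ∑ u, κ * W.prob u y₂ * W.prob (u₁ + u) y₁ = W.minus.prob u₁ (y₁, y₂) := by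
      refine Finset.sum_congr rfl fun u _ => ?_
      simp only [combined]; ring
    rw [hB, hg] at h
    exact h
  have hsum : ∀ u, ∑ y₁, κ * ∑ u₁,
      (√(W.prob (u₁ + u) y₁) - √(W.prob (u₁ + (u + v)) y₁)) ^ 2
        = 2 * (1 - W.bhattacharyyaShift v) := fun u => by
    rw [← bhattacharyyaShift_eq, ← Finset.mul_sum, Finset.sum_comm,
      ← sum_add_right (fun x => ∑ y, (√(W.prob x y) - √(W.prob (x + v) y)) ^ 2) u]
    simp only [add_assoc, hκ]
  calc _ = (1 - W.bhattacharyyaShift v) / 2 * (κ * W.bhattacharyyaShift v ^ 2) := by ring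
    _ ≤ (1 - W.bhattacharyyaShift v) / 2 * ∑ y, ∑ u, (κ * W.prob u y) *
        (κ * W.prob (u + v) y) / W.outputProb y :=
      mul_le_mul_of_nonneg_left (W.sq_bhattacharyyaShift_le v)
        (by linarith [W.bhattacharyyaShift_le_one v])
    _ = ∑ y₁, ∑ y₂, κ * ∑ u₁, (∑ u, (κ * W.prob u y₂) * (κ * W.prob (u + v) y₂) *
        (√(W.prob (u₁ + u) y₁) - √(W.prob (u₁ + (u + v)) y₁)) ^ 2) / (4 * W.outputProb y₂) := by
      rw [Finset.mul_sum]
      refine Eq.trans (Finset.sum_congr rfl fun y₂ _ => ?_) Finset.sum_comm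
      rw [Finset.mul_sum]
      have : ∀ y₁, κ * ∑ u₁, (∑ u, (κ * W.prob u y₂) * (κ * W.prob (u + v) y₂) *
          (√(W.prob (u₁ + u) y₁) - √(W.prob (u₁ + (u + v)) y₁)) ^ 2) / (4 * W.outputProb y₂)
          = ∑ u, (κ * W.prob u y₂) * (κ * W.prob (u + v) y₂) / (4 * W.outputProb y₂) *
            (κ * ∑ u₁, (√(W.prob (u₁ + u) y₁) - √(W.prob (u₁ + (u + v)) y₁)) ^ 2) := by
        intro y₁
        simp only [Finset.sum_div, Finset.mul_sum]
        rw [Finset.sum_comm]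
        refine Finset.sum_congr rfl fun u _ => Finset.sum_congr rfl fun u₁ _ => ?_
        ring
      rw [Finset.sum_congr rfl fun y₁ _ => this y₁, Finset.sum_comm]
      refine Finset.sum_congr rfl fun u _ => ?_
      rw [← Finset.mul_sum, hsum]
      ring
    _ ≤ _ := Finset.sum_le_sum fun y₁ _ => Finset.sum_le_sum fun y₂ _ =>
      mul_le_mul_of_nonneg_left (Finset.sum_le_sum fun u₁ _ => hgap y₁ y₂ u₁) hκ0.le

end Channel

/-! ### Polarization of the random channel -/

instance : IsProbabilityMeasure signMeasure := by
  unfold signMeasure; infer_instance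

/-- The sign sequence `ω` with its `n`-th coordinate reversed. -/
def flipSign (n : ℕ) (ω : ℕ → Bool) : ℕ → Bool := fun i => if i = n then !(ω i) else ω i

theorem map_not_uniform :
    (PMF.uniformOfFintype Bool).toMeasure.map not = (PMF.uniformOfFintype Bool).toMeasure := by
  refine Measure.ext_of_singleton fun b => ?_
  rw [Measure.map_apply (measurable_of_finite _) (measurableSet_singleton b),
    show not ⁻¹' {b} = {!b} by ext c; cases b <;> cases c <;> simp,
    PMF.toMeasure_apply_singleton _ _ (measurableSet_singleton _),
    PMF.toMeasure_apply_singleton _ _ (measurableSet_singleton _)]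
  simp

theorem measurePreserving_flipSign (n : ℕ) :
    MeasurePreserving (flipSign n) signMeasure signMeasure := by
  have hf : ∀ i, Measurable (fun b : Bool => if i = n then !b else b) := fun i =>
    measurable_of_finite _
  refine ⟨measurable_pi_lambda _ fun i => (hf i).comp (measurable_pi_apply i), ?_⟩
  have h := Measure.infinitePi_map_pi
    (μ := fun _ : ℕ => (PMF.uniformOfFintype Bool).toMeasure) hf
  refine h.trans ?_
  rw [signMeasure]
  congr 1
  funext i
  by_cases hi : i = n
  · simpa [hi] using map_not_uniform
  · simp [hi]

namespace Channel

variable {r : ℕ}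

theorem measurable_polarized (W : Channel.{u} r) (n : ℕ) (f : Channel.{u} r → ℝ) :
    Measurable fun ω => f (W.polarized ω n) := by
  induction n generalizing f with
  | zero => simp only [polarized]; exact measurable_const
  | succ n ih =>
    have : (fun ω => f (W.polarized ω (n + 1))) = fun ω => if ω n = true
        then f (W.polarized ω n).plus else f (W.polarized ω n).minus := by
      funext ω
      simp only [polarized, step]
      split_ifs <;> rfl
    rw [this]
    exact Measurable.ite (measurableSet_eq_fun (measurable_pi_apply n) measurable_const)
      (ih fun V => f V.plus) (ih fun V => f V.minus)

theorem integrable_polarized (W : Channel.{u} r) (n : ℕ) (f : Channel.{u} r → ℝ) :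
    Integrable (fun ω => f (W.polarized ω n)) signMeasure := by
  suffices h : ∃ C, ∀ ω, ‖f (W.polarized ω n)‖ ≤ C by
    obtain ⟨C, hC⟩ := h
    exact .of_bound (W.measurable_polarized n f).aestronglyMeasurable C (.of_forall hC)
  induction n generalizing f with
  | zero => exact ⟨‖f W‖, fun _ => le_rfl⟩
  | succ n ih =>
    obtain ⟨C₁, h₁⟩ := ih fun V => f V.plus
    obtain ⟨C₂, h₂⟩ := ih fun V => f V.minus
    refine ⟨max C₁ C₂, fun ω => ?_⟩
    simp only [polarized, step]
    split_ifs
    · exact (h₁ ω).trans (le_max_left _ _)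
    · exact (h₂ ω).trans (le_max_right _ _)

theorem polarized_congr (W : Channel.{u} r) {n : ℕ} {ω ω' : ℕ → Bool} (h : ∀ i < n, ω i = ω' i) :
    W.polarized ω n = W.polarized ω' n := by
  induction n with
  | zero => rfl
  | succ n ih =>
    rw [polarized, polarized, ih fun i hi => h i (hi.trans n.lt_succ_self), h n n.lt_succ_self]

/-- Conditioning on the first `n` signs: averaging `ω` with the sequence whose `n`-th sign is reversed
replaces the last step by the mean over both transforms. -/
theorem integral_polarized_succ (W : Channel.{u} r) (n : ℕ) (f : Channel.{u} r → ℝ) :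
    ∫ ω, f (W.polarized ω (n + 1)) ∂signMeasure =
      ∫ ω, (f (W.polarized ω n).plus + f (W.polarized ω n).minus) / 2 ∂signMeasure := by
  have hint := W.integrable_polarized (n + 1) f
  have hmp := measurePreserving_flipSign n
  have hflip : ∫ ω, f (W.polarized (flipSign n ω) (n + 1)) ∂signMeasure =
      ∫ ω, f (W.polarized ω (n + 1)) ∂signMeasure := by
    conv_rhs => rw [← hmp.map_eq]
    exact (integral_map hmp.measurable.aemeasurable
      (W.measurable_polarized (n + 1) f).aestronglyMeasurable).symm
  have hsum : ∀ ω, f (W.polarized ω (n + 1)) + f (W.polarized (flipSign n ω) (n + 1)) =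
      f (W.polarized ω n).plus + f (W.polarized ω n).minus := fun ω => by
    have h : W.polarized (flipSign n ω) n = W.polarized ω n :=
      W.polarized_congr fun i hi => by simp [flipSign, hi.ne]
    simp only [polarized, step, h]
    cases hω : ω n <;> simp [flipSign, hω, add_comm]
  have hadd := integral_add hint (hmp.integrable_comp_of_integrable hint)
  simp only [Function.comp_apply] at hadd
  rw [integral_div, ← integral_congr_ae (.of_forall hsum), hadd, hflip]
  ring

/-- The probability that some `Z_v(W_n)` lies in `[η, 1 - η]` tends to `0`. The second moments of
`I(W_n)` increase and are bounded, so their increments `𝔼 (I(W_n) - I(W_n⁻))²` tend to `0`, and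
Markov's inequality applies. -/
theorem tendsto_measure_exists_mem_Icc (W : Channel.{u} r) {η : ℝ} (hη : 0 < η) :
    Filter.Tendsto (fun n => signMeasure.real {ω | ∃ v,
      (W.polarized ω n).bhattacharyyaShift v ∈ Set.Icc η (1 - η)}) Filter.atTop (nhds 0) := by
  set a : ℕ → ℝ := fun n => ∫ ω, (W.polarized ω n).information ^ 2 ∂signMeasure with ha
  set d : ℕ → ℝ := fun n => ∫ ω, ((W.polarized ω n).information
    - (W.polarized ω n).minus.information) ^ 2 ∂signMeasure with hd
  have hstep : ∀ n, a (n + 1) = a n + d n := fun n => by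
    have h := W.integral_polarized_succ n fun V => V.information ^ 2
    simp only [ha, hd]
    rw [h, ← integral_add (W.integrable_polarized n fun V => V.information ^ 2)
      (W.integrable_polarized n fun V => (V.information - V.minus.information) ^ 2)]
    refine integral_congr_ae (.of_forall fun ω => ?_)
    have hp : (W.polarized ω n).plus.information =
        2 * (W.polarized ω n).information - (W.polarized ω n).minus.information := by
      linarith [(W.polarized ω n).information_plus_add_information_minus]
    simp only [hp]
    ring
  have hd0 : ∀ n, 0 ≤ d n := fun n => integral_nonneg fun ω => sq_nonneg _
  have hmono : Monotone a := monotone_nat_of_le_succ fun n => by linarith [hstep n, hd0 n]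
  have hbdd : BddAbove (Set.range a) := by
    refine ⟨log (2 ^ r) ^ 2, ?_⟩
    rintro _ ⟨n, rfl⟩
    calc a n ≤ ∫ _ω, log (2 ^ r) ^ 2 ∂signMeasure :=
          integral_mono (W.integrable_polarized n fun V => V.information ^ 2)
            (integrable_const _) fun ω =>
              pow_le_pow_left₀ (information_nonneg _) (information_le _) 2
      _ = _ := by simp
  have hdlim : Filter.Tendsto d Filter.atTop (nhds 0) := by
    have h := tendsto_atTop_ciSup hmono hbdd
    have h' := ((Filter.tendsto_add_atTop_iff_nat 1).2 h).sub h
    rw [sub_self] at h'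
    exact h'.congr fun n => by rw [hstep]; ring
  set c : ℝ := (1 / (2 : ℝ) ^ r / 2 * η * η ^ 2) ^ 2 with hc
  have hcpos : 0 < c := by positivity
  have hdc : Filter.Tendsto (fun n => d n / c) Filter.atTop (nhds 0) := by
    simpa using hdlim.div_const c
  refine squeeze_zero (fun n => measureReal_nonneg) (fun n => ?_) hdc
  rw [le_div_iff₀' hcpos]
  refine le_trans (mul_le_mul_of_nonneg_left (measureReal_mono ?_) hcpos.le)
    (mul_meas_ge_le_integral_of_nonneg (.of_forall fun ω => sq_nonneg _)
      (W.integrable_polarized n fun V => (V.information - V.minus.information) ^ 2) c)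
  rintro ω ⟨v, hv1, hv2⟩
  refine pow_le_pow_left₀ (by positivity) (le_trans ?_
    ((W.polarized ω n).information_sub_information_minus_ge v)) 2
  have h1 : η ≤ 1 - (W.polarized ω n).bhattacharyyaShift v := by linarith
  have h0 := hη.le.trans h1
  gcongr

end Channel

variable {r : ℕ}

/-! ### The ordered weight on the alphabet -/

/-- The weight records the 2-adic valuation. -/
theorem orderedWeight_le_iff {v : Alphabet r} {i : ℕ} (hi : i ≤ r) :
    orderedWeight v ≤ i ↔ 2 ^ (r - i) ∣ v.val := by
  have hzero : ∀ j, bit (0 : Alphabet r) j = false := fun j => by simp [bit]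
  have hsup : orderedWeight v ≤ i ↔ ∀ j, 1 ≤ j → j ≤ r → bit v j = true → j ≤ i := by
    rw [orderedWeight, orderedDist, Finset.sup_le_iff]
    refine forall_congr' fun j => ?_
    rw [Finset.mem_filter, Finset.mem_Icc, hzero, Bool.ne_false_iff, and_imp, and_imp, id]
  rw [hsup, Nat.dvd_iff_mod_eq_zero]
  constructor
  · intro h
    refine Nat.eq_of_testBit_eq fun k => ?_
    rw [Nat.testBit_mod_two_pow, Nat.zero_testBit]
    by_contra hne
    rw [Bool.not_eq_false, Bool.and_eq_true, decide_eq_true_eq] at hne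
    have hj := h (r - k) (by omega) (by omega) (by
      rw [bit, show r - (r - k) = k by omega]; exact hne.2)
    omega
  · intro h j hj1 hj2 hb
    by_contra hlt
    have hmod : (v.val % 2 ^ (r - i)).testBit (r - j) = true := by
      rw [Nat.testBit_mod_two_pow, Bool.and_eq_true, decide_eq_true_eq]
      exact ⟨by omega, hb⟩
    rw [h, Nat.zero_testBit] at hmod
    exact Bool.false_ne_true hmod

theorem orderedWeight_le (v : Alphabet r) : orderedWeight v ≤ r := by
  rw [orderedWeight_le_iff le_rfl]; simp

theorem card_orderedWeight_le {i : ℕ} (hi : i ≤ r) :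
    (Finset.univ.filter fun v : Alphabet r => orderedWeight v ≤ i).card = 2 ^ i := by
  rw [← Finset.card_range (2 ^ i)]
  symm
  have hpow : 2 ^ (r - i) * 2 ^ i = 2 ^ r := by rw [← pow_add]; congr 1; omega
  have hval : ∀ k < 2 ^ i, (((2 ^ (r - i) * k : ℕ) : Alphabet r)).val = 2 ^ (r - i) * k :=
    fun k hk => ZMod.val_natCast_of_lt (by rw [← hpow]; gcongr)
  refine Finset.card_bij (fun k _ => ((2 ^ (r - i) * k : ℕ) : Alphabet r)) ?_ ?_ ?_
  · intro k hk
    rw [Finset.mem_range] at hk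
    rw [Finset.mem_filter, orderedWeight_le_iff hi, hval k hk]
    exact ⟨Finset.mem_univ _, dvd_mul_right _ _⟩
  · intro k hk l hl h
    rw [Finset.mem_range] at hk hl
    have := congrArg ZMod.val h
    rw [hval k hk, hval l hl] at this
    exact Nat.eq_of_mul_eq_mul_left (by positivity) this
  · intro v hv
    rw [Finset.mem_filter, orderedWeight_le_iff hi] at hv
    obtain ⟨m, hm⟩ := hv.2
    refine ⟨m, ?_, ?_⟩
    · rw [Finset.mem_range]
      have h := ZMod.val_lt v
      rw [hm, ← hpow] at h
      exact lt_of_mul_lt_mul_left h (by positivity)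
    · rw [← hm, ZMod.natCast_zmod_val]

theorem card_orderedWeight_eq {i : ℕ} (hi : 1 ≤ i) (hir : i ≤ r) :
    (Finset.univ.filter fun v : Alphabet r => orderedWeight v = i).card = 2 ^ (i - 1) := by
  obtain ⟨j, rfl⟩ : ∃ j, i = j + 1 := ⟨i - 1, by omega⟩
  have h1 := card_orderedWeight_le (r := r) hir
  have h2 := card_orderedWeight_le (r := r) (i := j) (by omega)
  have h3 : (Finset.univ.filter fun v : Alphabet r => orderedWeight v ≤ j + 1) =
      (Finset.univ.filter fun v : Alphabet r => orderedWeight v ≤ j) ∪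
      (Finset.univ.filter fun v : Alphabet r => orderedWeight v = j + 1) := by
    ext v; simp only [Finset.mem_filter, Finset.mem_union, Finset.mem_univ, true_and]; omega
  rw [h3, Finset.card_union_of_disjoint, h2, pow_succ] at h1
  · rw [Nat.add_sub_cancel]; omega
  · rw [Finset.disjoint_filter]
    intro v _ hv; omega

/-- The symbols of weight at most `orderedWeight v` form the subgroup generated by `v`: `v` is
`2 ^ (r - orderedWeight v)` times an odd, hence invertible, factor. -/
theorem exists_nsmul_eq_of_orderedWeight_le {v w : Alphabet r}
    (h : orderedWeight w ≤ orderedWeight v) :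
    ∃ m : ℕ, w = m • v := by
  rcases Nat.eq_zero_or_pos (orderedWeight v) with h0 | hpos
  · refine ⟨0, ?_⟩
    have hw := (orderedWeight_le_iff (Nat.zero_le r)).1 (h.trans h0.le)
    rw [zero_smul, ← ZMod.val_eq_zero]
    exact Nat.eq_zero_of_dvd_of_lt hw (ZMod.val_lt w)
  set k := orderedWeight v with hk
  have hkr : k ≤ r := orderedWeight_le v
  obtain ⟨a, ha⟩ := (orderedWeight_le_iff hkr).1 hk.ge
  obtain ⟨b, hb⟩ := (orderedWeight_le_iff hkr).1 h
  have hodd : ¬ 2 ∣ a := by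
    rintro ⟨c, rfl⟩
    have h1 : orderedWeight v ≤ k - 1 := by
      rw [orderedWeight_le_iff (by omega)]
      refine ⟨c, ?_⟩
      rw [ha, ← mul_assoc, ← pow_succ]
      congr 2; omega
    omega
  have hcop : Nat.Coprime a (2 ^ r) :=
    Nat.Coprime.pow_right r ((Nat.Prime.coprime_iff_not_dvd Nat.prime_two).2 hodd).symm
  have hv : v = ((2 ^ (r - k) * a : ℕ) : Alphabet r) := by rw [← ha, ZMod.natCast_zmod_val]
  have hw : w = ((2 ^ (r - k) * b : ℕ) : Alphabet r) := by rw [← hb, ZMod.natCast_zmod_val]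
  -- With `v = 2 ^ (r - k) * a` and `w = 2 ^ (r - k) * b`, the multiplier is `b / a` modulo `2 ^ r`.
  refine ⟨b * ((a : Alphabet r)⁻¹).val, ?_⟩
  have hinv := ZMod.coe_mul_inv_eq_one a hcop
  rw [nsmul_eq_mul, Nat.cast_mul, ZMod.natCast_zmod_val, hw]
  conv_rhs => rw [hv]
  rw [Nat.cast_mul, Nat.cast_mul]
  linear_combination (-(b : Alphabet r) * ((2 ^ (r - k) : ℕ) : Alphabet r)) * hinv

/-! ### Extremal channels lie in one of the regions -/

namespace Channel

/-- If no `Z_v` is intermediate, the `v` with `Z_v` close to `1` are closed under addition by the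
triangle inequality, so they form a subgroup of `ℤ/2^r`, which is given by a bound on the weight. -/
theorem exists_threshold (W : Channel.{u} r) {η : ℝ} (hη0 : 0 < η) (hη : η < 1 / 5)
    (h : ∀ v, W.bhattacharyyaShift v ∉ Set.Icc η (1 - η)) :
    ∃ k ≤ r, ∀ v, (orderedWeight v ≤ k → 1 - η < W.bhattacharyyaShift v) ∧
      (k < orderedWeight v → W.bhattacharyyaShift v < η) := by
  have hor : ∀ v, η ≤ W.bhattacharyyaShift v → 1 - η < W.bhattacharyyaShift v := fun v hv =>
    not_le.1 fun hv' => h v ⟨hv, hv'⟩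
  have hzero : 1 - η < W.bhattacharyyaShift 0 := by rw [bhattacharyyaShift_zero]; linarith
  have hadd : ∀ v w, 1 - η < W.bhattacharyyaShift v → 1 - η < W.bhattacharyyaShift w →
      1 - η < W.bhattacharyyaShift (v + w) := fun v w hv hw =>
    -- `1 - Z_{v + w} < 4η < 1 - η` because `η < 1 / 5`
    hor _ (by linarith [W.one_sub_bhattacharyyaShift_add_le v w])
  have hsmul : ∀ v, 1 - η < W.bhattacharyyaShift v → ∀ m : ℕ,
      1 - η < W.bhattacharyyaShift (m • v) := fun v hv m => by
    induction m with
    | zero => rwa [zero_smul]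
    | succ m ih => rw [succ_nsmul]; exact hadd _ _ ih hv
  obtain ⟨v₀, hv₀, hmax⟩ := Finset.exists_max_image
    (Finset.univ.filter fun v => 1 - η < W.bhattacharyyaShift v) orderedWeight
    ⟨0, Finset.mem_filter.2 ⟨Finset.mem_univ _, hzero⟩⟩
  refine ⟨orderedWeight v₀, orderedWeight_le v₀, fun w => ⟨fun hw => ?_, fun hw => ?_⟩⟩
  · obtain ⟨m, rfl⟩ := exists_nsmul_eq_of_orderedWeight_le hw
    exact hsmul _ (Finset.mem_filter.1 hv₀).2 m
  · by_contra hlt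
    have := hmax w (Finset.mem_filter.2 ⟨Finset.mem_univ _, hor w (not_lt.1 hlt)⟩)
    omega

theorem mean_orderedWeight_const {i : ℕ} (hi : 1 ≤ i) (hir : i ≤ r) (c : ℝ) :
    1 / (2 : ℝ) ^ (i - 1) *
      ∑ _v ∈ Finset.univ.filter (fun v : Alphabet r => orderedWeight v = i), c = c := by
  rw [Finset.sum_const, card_orderedWeight_eq hi hir, nsmul_eq_mul]
  push_cast
  field_simp

theorem orderedWeight_filter_nonempty {i : ℕ} (hi : 1 ≤ i) (hir : i ≤ r) :
    (Finset.univ.filter fun v : Alphabet r => orderedWeight v = i).Nonempty := by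
  rw [← Finset.card_pos, card_orderedWeight_eq hi hir]
  positivity

theorem avgBhattacharyya_nonneg (W : Channel.{u} r) (i : ℕ) : 0 ≤ W.avgBhattacharyya i :=
  mul_nonneg (by positivity) (Finset.sum_nonneg fun v _ => W.bhattacharyyaShift_nonneg v)

theorem avgBhattacharyya_le_one (W : Channel.{u} r) {i : ℕ} (hi : 1 ≤ i) (hir : i ≤ r) :
    W.avgBhattacharyya i ≤ 1 :=
  (mul_le_mul_of_nonneg_left (Finset.sum_le_sum fun v _ => W.bhattacharyyaShift_le_one v)
    (by positivity)).trans_eq (mean_orderedWeight_const hi hir 1)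

theorem avgBhattacharyya_lt (W : Channel.{u} r) {i : ℕ} (hi : 1 ≤ i) (hir : i ≤ r) {c : ℝ}
    (h : ∀ v, orderedWeight v = i → W.bhattacharyyaShift v < c) : W.avgBhattacharyya i < c :=
  (mul_lt_mul_of_pos_left (Finset.sum_lt_sum_of_nonempty (orderedWeight_filter_nonempty hi hir)
    fun v hv => h v (Finset.mem_filter.1 hv).2) (by positivity)).trans_eq
    (mean_orderedWeight_const hi hir c)

theorem lt_avgBhattacharyya (W : Channel.{u} r) {i : ℕ} (hi : 1 ≤ i) (hir : i ≤ r) {c : ℝ}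
    (h : ∀ v, orderedWeight v = i → c < W.bhattacharyyaShift v) : c < W.avgBhattacharyya i :=
  (mean_orderedWeight_const hi hir c).symm.trans_lt
    (mul_lt_mul_of_pos_left (Finset.sum_lt_sum_of_nonempty (orderedWeight_filter_nonempty hi hir)
      fun v hv => h v (Finset.mem_filter.1 hv).2) (by positivity))

theorem exists_mem_region (W : Channel.{u} r) {η ε : ℝ} (hη0 : 0 < η) (hη : η < 1 / 5)
    (hηε : η ≤ ε) (h : ∀ v, W.bhattacharyyaShift v ∉ Set.Icc η (1 - η)) :
    ∃ k ≤ r, (fun i : Fin r => W.avgBhattacharyya (i.val + 1)) ∈ region r k ε := by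
  obtain ⟨k, hk, hW⟩ := W.exists_threshold hη0 hη h
  refine ⟨k, hk, fun i _ => ?_⟩
  have hi : 1 ≤ i.val + 1 := Nat.le_add_left 1 _
  have hir : i.val + 1 ≤ r := i.isLt
  dsimp only
  split_ifs with hik
  · refine ⟨?_, W.avgBhattacharyya_le_one hi hir⟩
    have := W.lt_avgBhattacharyya hi hir (c := 1 - η) fun v hv => (hW v).1 (by omega)
    linarith
  · exact ⟨W.avgBhattacharyya_nonneg _,
      (W.avgBhattacharyya_lt hi hir fun v hv => (hW v).2 (by omega)).trans_le hηε⟩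

end Channel

theorem disjoint_regionEvent (W : Channel.{u} r) {ε : ℝ} (hε : ε ≤ 1 / 2) {k₁ k₂ : ℕ}
    (hk : k₁ < k₂) (hk₂ : k₂ ≤ r) (n : ℕ) :
    Disjoint (regionEvent W ε k₁ n) (regionEvent W ε k₂ n) := by
  rw [Set.disjoint_left]
  intro ω h₁ h₂
  have h₁' := h₁ ⟨k₁, by omega⟩ (Set.mem_univ _)
  have h₂' := h₂ ⟨k₁, by omega⟩ (Set.mem_univ _)
  simp only [lt_irrefl, if_false, hk, if_true] at h₁' h₂'
  linarith [h₁'.2, h₂'.1]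

end QaryPolar

theorem proposition2 (r : ℕ) (hr : 2 ≤ r) (W : QaryPolar.Channel.{u} r)
    (ε δ : ℝ) (hε : 0 < ε) (hδ : 0 < δ) :
    (ε ≤ 1 / 2 → ∀ n : ℕ, ∀ k₁ ≤ r, ∀ k₂ ≤ r, k₁ ≠ k₂ →
      Disjoint (QaryPolar.regionEvent W ε k₁ n) (QaryPolar.regionEvent W ε k₂ n)) ∧
    ∃ n₀ : ℕ, ∀ n ≥ n₀,
      1 - δ ≤ QaryPolar.signMeasure.real (⋃ k ∈ Finset.range (r + 1),
        QaryPolar.regionEvent W ε k n) := by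
  refine ⟨fun hε' n k₁ hk₁ k₂ hk₂ hne => ?_, ?_⟩
  · rcases hne.lt_or_gt with h | h
    · exact QaryPolar.disjoint_regionEvent W hε' h hk₂ n
    · exact (QaryPolar.disjoint_regionEvent W hε' h hk₁ n).symm
  -- Any margin at most `ε` and below `1 / 5`, as `exists_mem_region` requires, would do.
  have hη0 : 0 < min ε (1 / 6) := lt_min hε (by norm_num)
  obtain ⟨n₀, hn₀⟩ := Filter.eventually_atTop.1
    ((W.tendsto_measure_exists_mem_Icc hη0).eventually (gt_mem_nhds hδ))
  refine ⟨n₀, fun n hn => ?_⟩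
  have hbad := hn₀ n hn
  set bad : Set (ℕ → Bool) := {ω | ∃ v,
    (W.polarized ω n).bhattacharyyaShift v ∈ Set.Icc (min ε (1 / 6)) (1 - min ε (1 / 6))}
  set good := ⋃ k ∈ Finset.range (r + 1), QaryPolar.regionEvent W ε k n
  have hcover : Set.univ ⊆ good ∪ bad := by
    intro ω _
    by_cases hω : ω ∈ bad
    · exact Or.inr hω
    · obtain ⟨k, hk, hmem⟩ := (W.polarized ω n).exists_mem_region hη0
        ((min_le_right _ _).trans_lt (by norm_num)) (min_le_left ε _)
        fun v hv => hω ⟨v, hv⟩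
      exact Or.inl (Set.mem_biUnion (Finset.mem_coe.2 (Finset.mem_range.2 (by omega))) hmem)
  have h1 := (measureReal_mono (μ := QaryPolar.signMeasure) hcover).trans
    (measureReal_union_le good bad)
  rw [probReal_univ] at h1
  linarith
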